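/- A foliation of degree $N$ of $\mathbb{P}^2(\mathbb{C})$ is given, uniquely up to multiplication by a nonzero constant, by a $1$-form $\omega = a\,\mathrm{d}X + b\,\mathrm{d}Y + c\,\mathrm{d}Z$ on $\mathbb{C}^3$, where $a, b, c \in \mathbb{C}[X,Y,Z]$ are homogeneous of degree $N+1$, have no common nonconstant factor, and satisfy $aX + bY + cZ = 0$. Its singular points are the points of $\mathbb{P}^2(\mathbb{C})$ at which $a = b = c = 0$, and in the affine chart $Z = 1$ it is described by the $1$-form $a(x,y,1)\,\mathrm{d}x + b(x,y,1)\,\mathrm{d}y$. The group $\mathrm{Aut}(\mathbb{P}^2(\mathbb{C})) = \mathrm{PGL}_3(\mathbb{C})$ acts on these foliations by linear changes of the coordinates $X, Y, Z$. **Theorem.** Up to automorphisms of $\mathbb{P}^2(\mathbb{C})$ there are exactly four foliations $\mathcal{F}_1, \ldots, \mathcal{F}_4$ of degree $2$ of the complex projective plane with a single singular point. They are described, in the affine chart $Z = 1$, by the $1$-forms $$\omega_1 = x^2\,\mathrm{d}x + y^2(x\,\mathrm{d}y - y\,\mathrm{d}x),$$ $$\omega_2 = x^2\,\mathrm{d}x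 + (x + y^2)(x\,\mathrm{d}y - y\,\mathrm{d}x),$$ $$\omega_3 = xy\,\mathrm{d}x + (x^2 + y^2)(x\,\mathrm{d}y - y\,\mathrm{d}x),$$ $$\omega_4 = (x + y^2 - x^2y)\,\mathrm{d}y + x(x + y^2)\,\mathrm{d}x.$$ That is: each $\mathcal{F}_i$ is a foliation of degree $2$ with exactly one singular point; no two of the $\mathcal{F}_i$ are conjugate under $\mathrm{Aut}(\mathbb{P}^2(\mathbb{C}))$; and every foliation of degree $2$ of $\mathbb{P}^2(\mathbb{C})$ with exactly one singular point is conjugate under $\mathrm{Aut}(\mathbb{P}^2(\mathbb{C}))$ to one of them. -/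

import Mathlib

open scoped LinearAlgebra.Projectivization MatrixGroups

noncomputable section

namespace PlaneFoliation

open MvPolynomial

/-- The complex projective plane. -/
abbrev P2 : Type := ℙ ℂ (Fin 3 → ℂ)

/-- The group of automorphisms of the complex projective plane. -/
abbrev AutP2 : Type := Matrix.ProjGenLinGroup (Fin 3) ℂ

/-- Polynomial 1-forms `a dX + b dY + c dZ` on `ℂ³`, encoded by `![a, b, c]`,
with `X, Y, Z = X 0, X 1, X 2`. -/
abbrev OneForm : Type := Fin 3 → MvPolynomial (Fin 3) ℂ

/-- The 1-forms on `ℂ³` which define a foliation of degree `N` of the projective plane: the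
coefficients are homogeneous of degree `N + 1`, satisfy Euler's identity `a X + b Y + c Z = 0`,
and have no common component. -/
structure IsFoliationForm (N : ℕ) (ω : OneForm) : Prop where
  homogeneous : ∀ i, (ω i).IsHomogeneous (N + 1)
  euler : ∑ i, ω i * X i = 0
  no_common_component : ∀ d : MvPolynomial (Fin 3) ℂ, (∀ i, d ∣ ω i) → IsUnit d

/-- Two forms define the same foliation iff they differ by a nonzero constant. -/
def formSetoid (N : ℕ) : Setoid {ω : OneForm // IsFoliationForm N ω} where
  r ω η := ∃ c : ℂˣ, (c : ℂ) • ω.1 = η.1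
  iseqv :=
    { refl := fun _ => ⟨1, by simp⟩
      symm := by
        rintro ω η ⟨c, h⟩
        exact ⟨c⁻¹, by rw [← h, smul_smul]; simp⟩
      trans := by
        rintro ω η θ ⟨c, h⟩ ⟨d, k⟩
        exact ⟨d * c, by rw [← k, ← h, smul_smul, Units.val_mul]⟩ }

/-- Foliations of degree `N` of the complex projective plane. -/
def Foliation (N : ℕ) : Type := Quotient (formSetoid N)

/-- The foliation defined by a form. -/
def Foliation.mk {N : ℕ} (ω : OneForm) (hω : IsFoliationForm N ω) : Foliation N :=
  Quotient.mk (formSetoid N) ⟨ω, hω⟩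

/-- The singular locus: the image in the projective plane of the common zeros `v ≠ 0` of the
coefficients of a defining form. -/
def Foliation.sing {N : ℕ} (F : Foliation N) : Set P2 :=
  Quotient.lift (s := formSetoid N)
    (fun ω => {p : P2 | ∃ (v : Fin 3 → ℂ) (hv : v ≠ 0),
      (∀ i, eval v (ω.1 i) = 0) ∧ Projectivization.mk ℂ v hv = p})
    (by
      rintro ω η ⟨c, h⟩
      have key : ∀ v i, eval v (η.1 i) = (c : ℂ) * eval v (ω.1 i) := by
        intro v i
        rw [← h]
        simp [smul_eval]
      ext p
      simp [key]) F

/-- The linear change of variables `f ↦ f ∘ g`. -/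
def subst (g : Matrix (Fin 3) (Fin 3) ℂ) : MvPolynomial (Fin 3) ℂ →ₐ[ℂ] MvPolynomial (Fin 3) ℂ :=
  aeval fun i => ∑ j, C (g i j) * X j

/-- The pull-back `g^* ω` of a 1-form by the linear map `v ↦ g v`. -/
def pullback (g : Matrix (Fin 3) (Fin 3) ℂ) (ω : OneForm) : OneForm :=
  fun j => ∑ i, C (g i j) * subst g (ω i)

theorem subst_X (g : Matrix (Fin 3) (Fin 3) ℂ) (i : Fin 3) :
    subst g (X i) = ∑ j, C (g i j) * X j := by
  simp [subst]

theorem subst_C (g : Matrix (Fin 3) (Fin 3) ℂ) (c : ℂ) : subst g (C c) = C c := by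
  simp [subst, algebraMap_eq]

theorem subst_subst (g h : Matrix (Fin 3) (Fin 3) ℂ) (p : MvPolynomial (Fin 3) ℂ) :
    subst h (subst g p) = subst (g * h) p := by
  have : (subst h).comp (subst g) = subst (g * h) := by
    apply MvPolynomial.algHom_ext
    intro i
    simp only [AlgHom.comp_apply, subst_X, map_sum, map_mul, subst_C, Matrix.mul_apply,
      Finset.mul_sum, Finset.sum_mul]
    rw [Finset.sum_comm]
    simp only [mul_assoc]
  exact DFunLike.congr_fun this p

theorem subst_scalar (u : ℂ) {p : MvPolynomial (Fin 3) ℂ} {n : ℕ} (hp : p.IsHomogeneous n) :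
    subst (Matrix.scalar (Fin 3) u) p = u ^ n • p := by
  have h : (fun i : Fin 3 => ∑ j, C (Matrix.scalar (Fin 3) u i j) * X j)
      = fun i => (C u * X i : MvPolynomial (Fin 3) ℂ) := by
    funext i
    simp [Matrix.diagonal_apply, apply_ite]
  rw [subst, h]
  conv_lhs => rw [p.as_sum]
  conv_rhs => rw [p.as_sum]
  rw [map_sum, Finset.smul_sum]
  refine Finset.sum_congr rfl fun d hd => ?_
  have hdeg : ∑ i, d i = n := by
    have := hp (mem_support_iff.mp hd)
    simpa [Finsupp.weight_apply, Finsupp.sum_fintype] using this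
  rw [aeval_monomial, algebraMap_eq, Finsupp.prod_fintype _ _ (by simp), monomial_eq,
    Finsupp.prod_fintype _ _ (by simp)]
  simp only [mul_pow, Finset.prod_mul_distrib, Finset.prod_pow_eq_pow_sum, hdeg, smul_eq_C_mul,
    map_pow]
  ring

theorem subst_one (p : MvPolynomial (Fin 3) ℂ) : subst 1 p = p := by
  have : subst 1 = AlgHom.id ℂ _ := by
    apply MvPolynomial.algHom_ext
    intro i
    simp [subst_X, Matrix.one_apply, apply_ite]
  rw [this]
  rfl

theorem pullback_pullback (g h : Matrix (Fin 3) (Fin 3) ℂ) (ω : OneForm) :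
    pullback h (pullback g ω) = pullback (g * h) ω := by
  funext k
  simp only [pullback, map_sum, map_mul, subst_C, subst_subst, Matrix.mul_apply,
    Finset.mul_sum, Finset.sum_mul]
  rw [Finset.sum_comm]
  refine Finset.sum_congr rfl fun i _ => Finset.sum_congr rfl fun j _ => ?_
  ring

theorem pullback_one (ω : OneForm) : pullback 1 ω = ω := by
  funext k
  simp [pullback, subst_one, Matrix.one_apply, apply_ite]

theorem pullback_smul (g : Matrix (Fin 3) (Fin 3) ℂ) (c : ℂ) (ω : OneForm) :
    pullback g (c • ω) = c • pullback g ω := by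
  funext k
  simp [pullback, Finset.smul_sum]

theorem IsFoliationForm.pullback {N : ℕ} {ω : OneForm} (hω : IsFoliationForm N ω) (g : GL (Fin 3) ℂ) :
    IsFoliationForm N (pullback g.1 ω) where
  homogeneous j := by
    refine IsHomogeneous.sum _ _ _ fun i _ => IsHomogeneous.C_mul ?_ _
    have := (hω.homogeneous i).aeval (n := 1) (fun i => ∑ j, C (g.1 i j) * X j)
      (fun i => IsHomogeneous.sum _ _ _ fun j _ => (isHomogeneous_X _ _).C_mul _)
    simpa [subst] using this
  euler := by
    have h := congrArg (subst g.1) hω.euler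
    simp only [map_sum, map_mul, subst_X, map_zero, Finset.mul_sum] at h
    rw [← h, Finset.sum_comm]
    refine Finset.sum_congr rfl fun i _ => ?_
    rw [PlaneFoliation.pullback, Finset.sum_mul]
    refine Finset.sum_congr rfl fun j _ => ?_
    ring
  no_common_component d hd := by
    have h1 : IsUnit (subst g⁻¹.1 d) := by
      apply hω.no_common_component
      intro i
      have e : ω = PlaneFoliation.pullback g⁻¹.1 (PlaneFoliation.pullback g.1 ω) := by
        rw [pullback_pullback, ← Units.val_mul, mul_inv_cancel, Units.val_one, pullback_one]
      rw [e]
      exact Finset.dvd_sum fun j _ => Dvd.dvd.mul_left (map_dvd (subst g⁻¹.1) (hd j)) _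
    have h2 := h1.map (subst g.1)
    rwa [subst_subst, ← Units.val_mul, inv_mul_cancel, Units.val_one, subst_one] at h2

/-- The pull-back of a foliation by a linear automorphism. -/
def Foliation.pullback {N : ℕ} (g : GL (Fin 3) ℂ) : Foliation N → Foliation N :=
  Quotient.map (sa := formSetoid N) (sb := formSetoid N)
    (fun ω => ⟨PlaneFoliation.pullback g.1 ω.1, ω.2.pullback g⟩) (by
      rintro ω η ⟨c, h⟩
      exact ⟨c, (pullback_smul _ _ _).symm.trans (congrArg _ h)⟩)

/-- The linear group acts on foliations by `g • F = (g⁻¹)^* F`, the image of `F` by `g`. -/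
instance (N : ℕ) : MulAction (GL (Fin 3) ℂ) (Foliation N) where
  smul g F := F.pullback g⁻¹
  one_smul F := by
    induction F using Quotient.ind with | _ ω => ?_
    refine congrArg (Quotient.mk (formSetoid N)) (Subtype.ext ?_)
    simp [pullback_one]
  mul_smul g h F := by
    induction F using Quotient.ind with | _ ω => ?_
    refine congrArg (Quotient.mk (formSetoid N)) (Subtype.ext ?_)
    change pullback (g * h)⁻¹.1 ω.1 = pullback g⁻¹.1 (pullback h⁻¹.1 ω.1)
    rw [pullback_pullback, ← Units.val_mul, mul_inv_rev]

/-- The action of the automorphisms of the projective plane on foliations of degree `N`. -/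
instance (N : ℕ) : MulAction AutP2 (Foliation N) :=
  Matrix.ProjGenLinGroup.mulActionOfGL (by
    intro u F
    induction F using Quotient.ind with | _ ω => ?_
    refine Quotient.sound (s := formSetoid N) ⟨u ^ (N + 2), ?_⟩
    have hinv : ((Matrix.GeneralLinearGroup.scalar (Fin 3) u)⁻¹).1
        = Matrix.scalar (Fin 3) (u⁻¹ : ℂˣ).1 := by
      rw [← map_inv]
      rfl
    change _ • pullback ((Matrix.GeneralLinearGroup.scalar (Fin 3) u)⁻¹).1 ω.1 = ω.1
    rw [hinv]
    funext k
    have hs : ∀ i, subst (Matrix.scalar (Fin 3) (u⁻¹ : ℂˣ).1) (ω.1 i) = _ :=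
      fun i => subst_scalar _ (ω.2.homogeneous i)
    simp only [Pi.smul_apply, pullback, hs]
    simp only [Matrix.scalar_apply, Matrix.diagonal_apply, apply_ite C, map_zero, ite_mul,
      zero_mul, Finset.sum_ite_eq', Finset.mem_univ, if_true, ← smul_eq_C_mul, smul_smul]
    have hu : (u : ℂ) ≠ 0 := u.ne_zero
    have : ((u ^ (N + 2) : ℂˣ) : ℂ) * (((u⁻¹ : ℂˣ) : ℂ) * ((u⁻¹ : ℂˣ) : ℂ) ^ (N + 1)) = 1 := by
      push_cast
      rw [← pow_succ', ← mul_pow, mul_inv_cancel₀ hu, one_pow]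
    rw [this, one_smul])

/-- The singular locus is equivariant under the automorphisms of the projective plane. -/
theorem Foliation.smul_mem_sing {N : ℕ} (g : AutP2) (F : Foliation N) {p : P2} (hp : p ∈ F.sing) :
    g • p ∈ (g • F).sing := by
  induction g using Matrix.ProjGenLinGroup.induction_on with | mk g => ?_
  induction F using Quotient.ind with | _ ω => ?_
  obtain ⟨v, hv, hz, rfl⟩ := hp
  refine ⟨g • v, (smul_ne_zero_iff_ne g).2 hv, fun j => ?_, rfl⟩
  have hgv : (fun i => ∑ j, (g⁻¹).1 i j * (g • v) j) = v := by
    change (g⁻¹).1.mulVec (g • v) = v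
    exact inv_smul_smul g v
  have hsub : ∀ q, eval (g • v) (subst (g⁻¹).1 q) = eval v q := by
    intro q
    have : (eval (g • v)).comp (subst (g⁻¹).1).toRingHom
        = eval (fun i => ∑ j, (g⁻¹).1 i j * (g • v) j) := by
      apply MvPolynomial.ringHom_ext
      · intro c
        simp
      · intro i
        simp [subst_X]
    have := DFunLike.congr_fun this q
    rw [hgv] at this
    exact this
  change eval (g • v) (PlaneFoliation.pullback (g⁻¹).1 ω.1 j) = 0
  simp only [PlaneFoliation.pullback, map_sum, map_mul, hsub, hz, mul_zero, Finset.sum_const_zero]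

/-- Polynomial 1-forms `P dx + Q dy` on `ℂ²`, encoded by `![P, Q]`. -/
abbrev AffineOneForm : Type := Fin 2 → MvPolynomial (Fin 2) ℂ

/-- The coordinate function `x` of `ℂ²`. -/
def x : MvPolynomial (Fin 2) ℂ := X 0

/-- The coordinate function `y` of `ℂ²`. -/
def y : MvPolynomial (Fin 2) ℂ := X 1

/-- The form `dx`. -/
def dx : AffineOneForm := ![1, 0]

/-- The form `dy`. -/
def dy : AffineOneForm := ![0, 1]

/-- The restriction `a(x, y, 1) dx + b(x, y, 1) dy` of `a dX + b dY + c dZ` to the affine chart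
`Z = 1`. -/
def restrictChart (ω : OneForm) : AffineOneForm :=
  ![aeval ![x, y, 1] (ω 0), aeval ![x, y, 1] (ω 1)]

/-- The foliation `F` is described by the polynomial 1-form `η` in the affine chart `Z = 1`. -/
def Foliation.IsDescribedBy {N : ℕ} (F : Foliation N) (η : AffineOneForm) : Prop :=
  ∃ (ω : OneForm) (hω : IsFoliationForm N ω), F = Foliation.mk ω hω ∧ restrictChart ω = η

/-- The four model forms in the affine chart `Z = 1`. -/
def modelForm : Fin 4 → AffineOneForm :=
  ![x ^ 2 • dx + y ^ 2 • (x • dy - y • dx),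
    x ^ 2 • dx + (x + y ^ 2) • (x • dy - y • dx),
    (x * y) • dx + (x ^ 2 + y ^ 2) • (x • dy - y • dx),
    (x + y ^ 2 - x ^ 2 * y) • dy + (x * (x + y ^ 2)) • dx]

end PlaneFoliation

end

/-!
A projective change of coordinates puts the singular point at `[0 : 0 : 1]`. In the chart `Z = 1`
the foliation is then given by a vector field `V₁ + V₂ + H R`, where `V₁ = (P₁, Q₁)` is linear,
`V₂ = (P₂, Q₂)` is quadratic, `H` is a quadratic form and `R` is the radial field
(`IsFoliationForm.exists_eq_form`).

The absence of other singular points is read off on the lines through the origin. Let `C2` and `C3`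
be the tangency forms `V₁ ∧ R` and `V₂ ∧ R`. On the line of direction `(u, v)`, the field is
tangent to the line only where `z C2 + w C3 = 0`, with `(x, y, z) = (w u, w v, z)`.
* If `C2 ≠ 0`, this gives one point other than the origin, which is singular exactly when the sextic
  `C2² H - C3 (V₁ ∧ V₂)` vanishes at `(u, v)`; so the sextic has no zero outside those of `C2`
  (`Coeffs.Good.sextic_ne_zero`).
* If `C2 = C3 = 0`, the field is radial along the line and its zeros are those of a binary quadratic
  form in `(z, w)`; so `V₁` and `V₂` vanish at `(u, v)`, and `H` does not
  (`Coeffs.Good.of_tangent`).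

When `V₁ = 0` only the second condition has content: `V₂` vanishes on every root of the cubic `C3`.
If `C3` has a single root this yields the first or the second model, according to the radial part
of `V₂`; if it has two roots, the third model; three roots would force `V₂ = 0`.

When `V₁ ≠ 0`, an eigenline of `V₁` is moved to the `y`-axis. The radial case is excluded by a root
of `C3`. Otherwise `C2` is `x²` or `x y` up to a factor, and the sextic, having no root
outside those of `C2`, has many vanishing coefficients (`Coeffs.Good.sexticCoeff_eq_zero`). These
coefficients exclude a nilpotent part and two nonzero eigenvalues, and in the saddle-node case they
determine `H` and leave, after linear changes of `X, Y, Z`, only the fourth model.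

The four models are told apart by an equivalence fixing `[0 : 0 : 1]`: its matrix is block
triangular, so the coefficients of `dZ`, which are `Z C2 + C3` up to sign, correspond to each other,
and for the first two models so does the dependence on `Z` of the coefficient of `dY`.
-/

open scoped LinearAlgebra.Projectivization MatrixGroups

noncomputable section

namespace PlaneFoliation

open MvPolynomial

/-! ### Linear equivalence of 1-forms -/

/-- Two forms are linearly equivalent if one is a nonzero multiple of the pull-back of the other by
an invertible linear map; the foliations they define are then conjugate. -/
def LinEquiv (ω η : OneForm) : Prop :=
  ∃ (g : GL (Fin 3) ℂ) (c : ℂˣ), (c : ℂ) • pullback g.1 ω = η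

theorem LinEquiv.symm {ω η : OneForm} : LinEquiv ω η → LinEquiv η ω := by
  rintro ⟨g, c, rfl⟩
  refine ⟨g⁻¹, c⁻¹, ?_⟩
  rw [pullback_smul, pullback_pullback, ← Units.val_mul, mul_inv_cancel, Units.val_one,
    pullback_one, smul_smul, ← Units.val_mul, inv_mul_cancel, Units.val_one, one_smul]

theorem LinEquiv.trans {ω η θ : OneForm} : LinEquiv ω η → LinEquiv η θ → LinEquiv ω θ := by
  rintro ⟨g, c, rfl⟩ ⟨h, d, rfl⟩
  refine ⟨g * h, d * c, ?_⟩
  rw [pullback_smul, pullback_pullback, smul_smul, Units.val_mul, Units.val_mul]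

theorem eval_subst (g : Matrix (Fin 3) (Fin 3) ℂ) (v : Fin 3 → ℂ) (f : MvPolynomial (Fin 3) ℂ) :
    eval v (subst g f) = eval (g.mulVec v) f := by
  have : (eval v).comp (subst g).toRingHom = eval (g.mulVec v) := by
    apply MvPolynomial.ringHom_ext
    · intro c
      simp
    · intro i
      simp [subst_X, Matrix.mulVec, dotProduct]
  exact DFunLike.congr_fun this f

theorem eval_pullback (g : Matrix (Fin 3) (Fin 3) ℂ) (v : Fin 3 → ℂ) (ω : OneForm) (j : Fin 3) :
    eval v (pullback g ω j) = ∑ i, g i j * eval (g.mulVec v) (ω i) := by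
  simp [pullback, eval_subst]

theorem linEquiv_of_eval {ω η : OneForm} (g : Matrix (Fin 3) (Fin 3) ℂ) (hg : g.det ≠ 0)
    {c : ℂ} (hc : c ≠ 0)
    (h : ∀ v j, c * ∑ i, g i j * eval (g.mulVec v) (ω i) = eval v (η j)) : LinEquiv ω η := by
  refine ⟨Matrix.GeneralLinearGroup.mkOfDetNeZero g hg, Units.mk0 c hc, ?_⟩
  funext j
  apply MvPolynomial.funext
  intro v
  rw [← h v j, ← eval_pullback]
  simp [smul_eval, Matrix.GeneralLinearGroup.mkOfDetNeZero]

/-- A vector is a zero of the pull-back exactly when its image is a zero of the form. -/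
theorem eval_pullback_eq_zero_iff (g : GL (Fin 3) ℂ) (ω : OneForm) (v : Fin 3 → ℂ) :
    (∀ j, eval v (pullback g.1 ω j) = 0) ↔ ∀ i, eval (g.1.mulVec v) (ω i) = 0 := by
  constructor
  · intro h
    have h1 : Matrix.vecMul (fun i => eval (g.1.mulVec v) (ω i)) g.1 = 0 := by
      funext j
      have := h j
      rw [eval_pullback] at this
      simpa [Matrix.vecMul, dotProduct, mul_comm] using this
    have h2 : Matrix.vecMul (fun i => eval (g.1.mulVec v) (ω i)) (g.1 * g⁻¹.1) = 0 := by
      rw [← Matrix.vecMul_vecMul, h1, Matrix.zero_vecMul]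
    rw [← Units.val_mul, mul_inv_cancel, Units.val_one, Matrix.vecMul_one] at h2
    exact fun i => congrFun h2 i
  · intro h j
    simp [eval_pullback, h]

theorem linEquiv_eval_zero {ω η : OneForm} {g : GL (Fin 3) ℂ} {c : ℂˣ}
    (h : (c : ℂ) • pullback g.1 ω = η) (v : Fin 3 → ℂ) :
    (∀ j, eval v (η j) = 0) ↔ ∀ i, eval (g.1.mulVec v) (ω i) = 0 := by
  rw [← eval_pullback_eq_zero_iff, ← h]
  simp [smul_eval]

/-! ### Forms whose only zeros lie on the third axis -/

/-- The common zeros of the coefficients lie on the third axis: the only possible singular point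
is `[0 : 0 : 1]`. -/
def OnlySingAtOrigin (ω : OneForm) : Prop :=
  ∀ v, (∀ i, eval v (ω i) = 0) → v 0 = 0 ∧ v 1 = 0

theorem mulVec_injective (g : GL (Fin 3) ℂ) : Function.Injective g.1.mulVec := fun v w h => by
  have : g⁻¹.1.mulVec (g.1.mulVec v) = g⁻¹.1.mulVec (g.1.mulVec w) := by rw [h]
  simpa [Matrix.mulVec_mulVec, ← Units.val_mul] using this

theorem OnlySingAtOrigin.of_linEquiv {ω η : OneForm} (hω : OnlySingAtOrigin ω)
    (h : LinEquiv ω η) (h0 : ∀ j, eval ![0, 0, 1] (η j) = 0) : OnlySingAtOrigin η := by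
  obtain ⟨g, c, h⟩ := h
  intro v hv
  have h1 := hω _ ((linEquiv_eval_zero h _).1 h0)
  have h2 := hω _ ((linEquiv_eval_zero h _).1 hv)
  -- `g v` and `g e₃` are both multiples of `e₃`, hence so is `v`
  have h3 : g.1.mulVec ((g.1.mulVec ![0, 0, 1] 2) • v)
      = g.1.mulVec ((g.1.mulVec v 2) • ![0, 0, 1]) := by
    rw [Matrix.mulVec_smul, Matrix.mulVec_smul]
    funext i
    fin_cases i <;> simp only [Pi.smul_apply, smul_eq_mul, Fin.zero_eta, Fin.mk_one,
      Fin.reduceFinMk, h1, h2, zero_mul, mul_comm]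
  have h4 := mulVec_injective g h3
  have h5 : g.1.mulVec ![0, 0, 1] 2 ≠ 0 := by
    intro h6
    have : g.1.mulVec ![0, 0, 1] = g.1.mulVec 0 := by
      rw [Matrix.mulVec_zero]
      funext i
      fin_cases i
      · exact h1.1
      · exact h1.2
      · exact h6
    simpa using congrFun (mulVec_injective g this) 2
  have h6 := congrFun h4 0
  have h7 := congrFun h4 1
  simp only [Pi.smul_apply, smul_eq_mul, Matrix.cons_val_zero, Matrix.cons_val_one, mul_zero,
    mul_eq_zero, h5, false_or] at h6 h7
  exact ⟨h6, h7⟩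

/-! ### Normal form at a singular point -/

/-- The coefficients of the vector field `(P₁ + P₂ + x H) ∂x + (Q₁ + Q₂ + y H) ∂y`, where `P₁, Q₁`
are linear and `P₂, Q₂, H` quadratic forms: `p i j` is the coefficient of `x ^ i y ^ j` in
`P₁ + P₂`, and similarly for the others. -/
structure Coeffs where
  p10 : ℂ
  p01 : ℂ
  q10 : ℂ
  q01 : ℂ
  p20 : ℂ
  p11 : ℂ
  p02 : ℂ
  q20 : ℂ
  q11 : ℂ
  q02 : ℂ
  h20 : ℂ
  h11 : ℂ
  h02 : ℂ

namespace Coeffs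

variable (s : Coeffs)

/-- The linear part of the first component of the vector field. -/
def P1 (u v : ℂ) : ℂ := s.p10 * u + s.p01 * v

/-- The linear part of the second component of the vector field. -/
def Q1 (u v : ℂ) : ℂ := s.q10 * u + s.q01 * v

/-- The quadratic part of the first component of the vector field. -/
def P2 (u v : ℂ) : ℂ := s.p20 * u ^ 2 + s.p11 * (u * v) + s.p02 * v ^ 2

/-- The quadratic part of the second component of the vector field. -/
def Q2 (u v : ℂ) : ℂ := s.q20 * u ^ 2 + s.q11 * (u * v) + s.q02 * v ^ 2

/-- The coefficient of the radial field in the cubic part of the vector field. -/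
def H (u v : ℂ) : ℂ := s.h20 * u ^ 2 + s.h11 * (u * v) + s.h02 * v ^ 2

/-- The homogeneous 1-form dual to the vector field, which vanishes at `[0 : 0 : 1]`. In the chart
`Z = 1` it is `(P₁ + P₂ + x H) dy - (Q₁ + Q₂ + y H) dx`. -/
def form : OneForm :=
  ![-(X 2 ^ 2 * (C s.q10 * X 0 + C s.q01 * X 1)
      + X 2 * (C s.q20 * X 0 ^ 2 + C s.q11 * (X 0 * X 1) + C s.q02 * X 1 ^ 2)
      + X 1 * (C s.h20 * X 0 ^ 2 + C s.h11 * (X 0 * X 1) + C s.h02 * X 1 ^ 2)),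
    X 2 ^ 2 * (C s.p10 * X 0 + C s.p01 * X 1)
      + X 2 * (C s.p20 * X 0 ^ 2 + C s.p11 * (X 0 * X 1) + C s.p02 * X 1 ^ 2)
      + X 0 * (C s.h20 * X 0 ^ 2 + C s.h11 * (X 0 * X 1) + C s.h02 * X 1 ^ 2),
    X 2 * (X 0 * (C s.q10 * X 0 + C s.q01 * X 1) - X 1 * (C s.p10 * X 0 + C s.p01 * X 1))
      + (X 0 * (C s.q20 * X 0 ^ 2 + C s.q11 * (X 0 * X 1) + C s.q02 * X 1 ^ 2)
        - X 1 * (C s.p20 * X 0 ^ 2 + C s.p11 * (X 0 * X 1) + C s.p02 * X 1 ^ 2))]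

theorem eval_form_zero (v : Fin 3 → ℂ) :
    eval v (s.form 0) = -(v 2 ^ 2 * s.Q1 (v 0) (v 1) + v 2 * s.Q2 (v 0) (v 1)
      + v 1 * s.H (v 0) (v 1)) := by
  simp [form, Q1, Q2, H]

theorem eval_form_one (v : Fin 3 → ℂ) :
    eval v (s.form 1) = v 2 ^ 2 * s.P1 (v 0) (v 1) + v 2 * s.P2 (v 0) (v 1)
      + v 0 * s.H (v 0) (v 1) := by
  simp [form, P1, P2, H]

theorem eval_form_two (v : Fin 3 → ℂ) :
    eval v (s.form 2) = v 2 * (v 0 * s.Q1 (v 0) (v 1) - v 1 * s.P1 (v 0) (v 1))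
      + (v 0 * s.Q2 (v 0) (v 1) - v 1 * s.P2 (v 0) (v 1)) := by
  simp [form, P1, P2, Q1, Q2]

theorem eval_form_origin (j : Fin 3) : eval ![0, 0, 1] (s.form j) = 0 := by
  fin_cases j
  · simp [eval_form_zero, Q1, Q2]
  · simp [eval_form_one, P1, P2]
  · simp [eval_form_two]

/-- The origin is the only singular point. -/
def Good : Prop := OnlySingAtOrigin s.form

variable {s}

theorem Good.of_linEquiv {t : Coeffs} (hs : s.Good) (h : LinEquiv s.form t.form) : t.Good :=
  OnlySingAtOrigin.of_linEquiv hs h t.eval_form_origin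

theorem Good.false_of_point (hs : s.Good) {u v z : ℂ} (huv : u ≠ 0 ∨ v ≠ 0)
    (hP : z ^ 2 * s.P1 u v + z * s.P2 u v + u * s.H u v = 0)
    (hQ : z ^ 2 * s.Q1 u v + z * s.Q2 u v + v * s.H u v = 0)
    (hC : z * (u * s.Q1 u v - v * s.P1 u v) + (u * s.Q2 u v - v * s.P2 u v) = 0) : False := by
  have h := hs ![u, v, z] fun j => by
    fin_cases j
    · simpa [eval_form_zero, -neg_add_rev] using hQ
    · simpa [eval_form_one] using hP
    · simpa [eval_form_two] using hC
  simp only [Matrix.cons_val_zero, Matrix.cons_val_one] at h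
  tauto

/-! ### The discriminating sextic -/

variable (s)

/-- The tangency form of the linear part with the radial field. -/
def C2 (u v : ℂ) : ℂ := s.P1 u v * v - s.Q1 u v * u

/-- The tangency form of the quadratic part with the radial field. -/
def C3 (u v : ℂ) : ℂ := s.P2 u v * v - s.Q2 u v * u

/-- A line through the origin along which `C2` does not vanish carries a singular point other than
the origin exactly when this sextic form vanishes along it. -/
def sextic (u v : ℂ) : ℂ :=
  s.C2 u v ^ 2 * s.H u v - s.C3 u v * (s.P1 u v * s.Q2 u v - s.Q1 u v * s.P2 u v)

variable {s}

theorem Good.sextic_ne_zero (hs : s.Good) {u v : ℂ} (h : s.C2 u v ≠ 0) : s.sextic u v ≠ 0 := by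
  intro h0
  -- the tangency locus `z C2 + w C3 = 0` meets the line `w (u, v)` at `z = C3`, `w = -C2`
  have h1 : u ≠ 0 ∨ v ≠ 0 := by
    by_contra! h'
    obtain ⟨rfl, rfl⟩ := h'
    simp [C2] at h
  refine hs.false_of_point (u := -s.C2 u v * u) (v := -s.C2 u v * v) (z := s.C3 u v) ?_ ?_ ?_ ?_
  · simpa [h] using h1
  · unfold sextic at h0
    simp only [C2, C3, P1, Q1, P2, Q2, H] at h0 ⊢
    linear_combination (- ((s.p10 * u + s.p01 * v) * v - (s.q10 * u + s.q01 * v) * u) * u) * h0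
  · unfold sextic at h0
    simp only [C2, C3, P1, Q1, P2, Q2, H] at h0 ⊢
    linear_combination (- ((s.p10 * u + s.p01 * v) * v - (s.q10 * u + s.q01 * v) * u) * v) * h0
  · simp only [C2, C3, P1, Q1, P2, Q2]
    ring

/-- A polynomial with a nonzero coefficient of positive degree has a root. -/
theorem exists_root_of_coeff_ne_zero {n : ℕ} (l : Fin n → ℂ) (k : Fin n) (hk : (k : ℕ) ≠ 0)
    (h : l k ≠ 0) : ∃ t, ∑ i, l i * t ^ (i : ℕ) = 0 := by
  let p : Polynomial ℂ := ∑ i, Polynomial.C (l i) * Polynomial.X ^ (i : ℕ)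
  have hc : p.coeff k = l k := by
    simp [p, Polynomial.coeff_X_pow, Fin.val_inj]
  obtain ⟨t, ht⟩ := IsAlgClosed.exists_root p fun h0 => h <| by
    rw [← hc, Polynomial.eq_C_of_degree_eq_zero h0, Polynomial.coeff_C, if_neg hk]
  refine ⟨t, ?_⟩
  simpa [p, Polynomial.IsRoot, Polynomial.eval_finsetSum] using ht

theorem exists_quadratic_root {a b c : ℂ} (h : a ≠ 0 ∨ b ≠ 0) :
    ∃ t, a * t ^ 2 + b * t + c = 0 := by
  have : ∃ t, ∑ i, ![c, b, a] i * t ^ (i : ℕ) = 0 := by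
    rcases h with h | h
    · exact exists_root_of_coeff_ne_zero _ 2 (by simp) h
    · exact exists_root_of_coeff_ne_zero _ 1 (by simp) h
  obtain ⟨t, ht⟩ := this
  simp only [Fin.sum_univ_three] at ht
  exact ⟨t, by simpa [add_comm, add_left_comm, add_assoc] using ht⟩

theorem exists_eq_mul_of_mul_eq {p q u v : ℂ} (huv : u ≠ 0 ∨ v ≠ 0) (h : p * v = q * u) :
    ∃ a, p = a * u ∧ q = a * v := by
  rcases huv with hu | hv
  · exact ⟨p / u, by field_simp, by field_simp; linear_combination -h⟩
  · exact ⟨q / v, by field_simp; linear_combination h, by field_simp⟩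

/-- On a line which is invariant, the field is radial and has no zero besides the origin; as its
restriction is given by a quadratic polynomial, this polynomial is a nonzero constant. -/
theorem Good.of_tangent (hs : s.Good) {u v : ℂ} (huv : u ≠ 0 ∨ v ≠ 0) (h2 : s.C2 u v = 0)
    (h3 : s.C3 u v = 0) :
    s.P1 u v = 0 ∧ s.Q1 u v = 0 ∧ s.P2 u v = 0 ∧ s.Q2 u v = 0 ∧ s.H u v ≠ 0 := by
  obtain ⟨a, ha, ha'⟩ := exists_eq_mul_of_mul_eq huv (sub_eq_zero.1 h2)
  obtain ⟨b, hb, hb'⟩ := exists_eq_mul_of_mul_eq huv (sub_eq_zero.1 h3)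
  have key : ∀ z, a * z ^ 2 + b * z + s.H u v ≠ 0 := by
    intro z hz
    refine hs.false_of_point huv (z := z) ?_ ?_ ?_
    · rw [ha, hb]; linear_combination u * hz
    · rw [ha', hb']; linear_combination v * hz
    · rw [ha, hb, ha', hb']; ring
  have hab : a = 0 ∧ b = 0 := by
    by_contra h
    obtain ⟨t, ht⟩ := exists_quadratic_root (a := a) (b := b) (c := s.H u v) (by tauto)
    exact key t ht
  have h0 := key 0
  simp_all

theorem Good.coeff_zero_of_vertical (hs : s.Good) (h1 : s.p01 = 0) (h2 : s.p02 = 0) :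
    s.q01 = 0 ∧ s.q02 = 0 ∧ s.h02 ≠ 0 := by
  have := hs.of_tangent (u := 0) (v := 1) (by simp) (by simp [C2, P1, h1]) (by simp [C3, P2, h2])
  simp [Q1, Q2, H] at this
  tauto

theorem Good.coeff_zero_of_horizontal (hs : s.Good) (h1 : s.q10 = 0) (h2 : s.q20 = 0) :
    s.p10 = 0 ∧ s.p20 = 0 ∧ s.h20 ≠ 0 := by
  have := hs.of_tangent (u := 1) (v := 0) (by simp) (by simp [C2, Q1, h1]) (by simp [C3, Q2, h2])
  simp [P1, P2, H] at this
  tauto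

/-! ### Elementary changes of coordinates -/

/-- The coefficients after exchanging the coordinates `x` and `y`. -/
def swap (s : Coeffs) : Coeffs where
  p10 := s.q01
  p01 := s.q10
  q10 := s.p01
  q01 := s.p10
  p20 := s.q02
  p11 := s.q11
  p02 := s.q20
  q20 := s.p02
  q11 := s.p11
  q02 := s.p20
  h20 := s.h02
  h11 := s.h11
  h02 := s.h20

theorem linEquiv_swap (s : Coeffs) : LinEquiv s.form s.swap.form := by
  refine linEquiv_of_eval !![0, 1, 0; 1, 0, 0; 0, 0, 1] (by simp [Matrix.det_fin_three])
    (c := -1) (by simp) fun v j => ?_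
  fin_cases j <;>
  simp [Fin.sum_univ_three, eval_form_zero, eval_form_one, eval_form_two,
    dotProduct, swap, P1, Q1, P2, Q2, H] <;> ring

/-- The coefficients after the substitution `x ↦ x + t y`. -/
def shearX (s : Coeffs) (t : ℂ) : Coeffs where
  p10 := s.p10 - t * s.q10
  p01 := s.p10 * t + s.p01 - t * (s.q10 * t + s.q01)
  q10 := s.q10
  q01 := s.q10 * t + s.q01
  p20 := s.p20 - t * s.q20
  p11 := 2 * t * s.p20 + s.p11 - t * (2 * t * s.q20 + s.q11)
  p02 := s.p20 * t ^ 2 + s.p11 * t + s.p02 - t * (s.q20 * t ^ 2 + s.q11 * t + s.q02)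
  q20 := s.q20
  q11 := 2 * t * s.q20 + s.q11
  q02 := s.q20 * t ^ 2 + s.q11 * t + s.q02
  h20 := s.h20
  h11 := 2 * t * s.h20 + s.h11
  h02 := s.h20 * t ^ 2 + s.h11 * t + s.h02

theorem linEquiv_shearX (s : Coeffs) (t : ℂ) : LinEquiv s.form (s.shearX t).form := by
  refine linEquiv_of_eval !![1, t, 0; 0, 1, 0; 0, 0, 1] (by simp [Matrix.det_fin_three])
    (c := 1) (by simp) fun v j => ?_
  fin_cases j <;>
  simp [Fin.sum_univ_three, eval_form_zero, eval_form_one, eval_form_two,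
    dotProduct, shearX, P1, Q1, P2, Q2, H] <;> ring

/-- The coefficients after the substitution `y ↦ y + t x`. -/
def shearY (s : Coeffs) (t : ℂ) : Coeffs where
  p10 := s.p01 * t + s.p10
  p01 := s.p01
  q10 := s.q01 * t + s.q10 - t * (s.p01 * t + s.p10)
  q01 := s.q01 - t * s.p01
  p20 := s.p02 * t ^ 2 + s.p11 * t + s.p20
  p11 := 2 * t * s.p02 + s.p11
  p02 := s.p02
  q20 := s.q02 * t ^ 2 + s.q11 * t + s.q20 - t * (s.p02 * t ^ 2 + s.p11 * t + s.p20)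
  q11 := 2 * t * s.q02 + s.q11 - t * (2 * t * s.p02 + s.p11)
  q02 := s.q02 - t * s.p02
  h20 := s.h02 * t ^ 2 + s.h11 * t + s.h20
  h11 := 2 * t * s.h02 + s.h11
  h02 := s.h02

theorem linEquiv_shearY (s : Coeffs) (t : ℂ) : LinEquiv s.form (s.shearY t).form := by
  refine linEquiv_of_eval !![1, 0, 0; t, 1, 0; 0, 0, 1] (by simp [Matrix.det_fin_three])
    (c := 1) (by simp) fun v j => ?_
  fin_cases j <;>
  simp [Fin.sum_univ_three, eval_form_zero, eval_form_one, eval_form_two,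
    dotProduct, shearY, P1, Q1, P2, Q2, H] <;> ring

/-- The coefficients after the substitution `Z ↦ Z + e X + f Y`, which moves the line at
infinity. -/
def twist (s : Coeffs) (e f : ℂ) : Coeffs where
  p10 := s.p10
  p01 := s.p01
  q10 := s.q10
  q01 := s.q01
  p20 := s.p20 + 2 * e * s.p10 + f * s.q10
  p11 := s.p11 + 2 * e * s.p01 + f * (s.p10 + s.q01)
  p02 := s.p02 + f * s.p01
  q20 := s.q20 + e * s.q10
  q11 := s.q11 + 2 * f * s.q10 + e * (s.p10 + s.q01)
  q02 := s.q02 + 2 * f * s.q01 + e * s.p01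
  h20 := s.h20 + e * s.p20 + f * s.q20 + e * (e * s.p10 + f * s.q10)
  h11 := s.h11 + e * s.p11 + f * s.q11 + e * (e * s.p01 + f * s.q01)
    + f * (e * s.p10 + f * s.q10)
  h02 := s.h02 + e * s.p02 + f * s.q02 + f * (e * s.p01 + f * s.q01)

theorem linEquiv_twist (s : Coeffs) (e f : ℂ) : LinEquiv s.form (s.twist e f).form := by
  refine linEquiv_of_eval !![1, 0, 0; 0, 1, 0; e, f, 1] (by simp [Matrix.det_fin_three])
    (c := 1) (by simp) fun v j => ?_
  fin_cases j <;>
  simp [Fin.sum_univ_three, eval_form_zero, eval_form_one, eval_form_two,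
    dotProduct, twist, P1, Q1, P2, Q2, H] <;> ring

/-- The coefficients after the substitution `(X, Y, Z) ↦ (X, ν Y, h Z)` and multiplication of the
form by `κ`. -/
def scale (s : Coeffs) (ν h κ : ℂ) : Coeffs where
  p10 := κ * ν * h ^ 2 * s.p10
  p01 := κ * ν ^ 2 * h ^ 2 * s.p01
  q10 := κ * h ^ 2 * s.q10
  q01 := κ * ν * h ^ 2 * s.q01
  p20 := κ * ν * h * s.p20
  p11 := κ * ν ^ 2 * h * s.p11
  p02 := κ * ν ^ 3 * h * s.p02
  q20 := κ * h * s.q20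
  q11 := κ * ν * h * s.q11
  q02 := κ * ν ^ 2 * h * s.q02
  h20 := κ * ν * s.h20
  h11 := κ * ν ^ 2 * s.h11
  h02 := κ * ν ^ 3 * s.h02

theorem linEquiv_scale (s : Coeffs) {ν h κ : ℂ} (hν : ν ≠ 0) (hh : h ≠ 0) (hκ : κ ≠ 0) :
    LinEquiv s.form (s.scale ν h κ).form := by
  refine linEquiv_of_eval !![1, 0, 0; 0, ν, 0; 0, 0, h] (by simp [Matrix.det_fin_three, hν, hh])
    hκ fun v j => ?_
  fin_cases j <;>
  simp [Fin.sum_univ_three, eval_form_zero, eval_form_one, eval_form_two,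
    dotProduct, scale, P1, Q1, P2, Q2, H] <;> ring

/-! ### The model coefficients -/

/-- The coefficients of the four model forms. -/
def model : Fin 4 → Coeffs :=
  ![{ p10 := 0, p01 := 0, q10 := 0, q01 := 0, p20 := 0, p11 := 0, p02 := 0,
      q20 := -1, q11 := 0, q02 := 0, h20 := 0, h11 := 0, h02 := 1 },
    { p10 := 0, p01 := 0, q10 := 0, q01 := 0, p20 := 1, p11 := 0, p02 := 0,
      q20 := -1, q11 := 1, q02 := 0, h20 := 0, h11 := 0, h02 := 1 },
    { p10 := 0, p01 := 0, q10 := 0, q01 := 0, p20 := 0, p11 := 0, p02 := 0,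
      q20 := 0, q11 := -1, q02 := 0, h20 := 1, h11 := 0, h02 := 1 },
    { p10 := 1, p01 := 0, q10 := 0, q01 := 0, p20 := 0, p11 := 0, p02 := 1,
      q20 := -1, q11 := 0, q02 := 0, h20 := 0, h11 := -1, h02 := 0 }]

/-- The form with these coefficients is linearly equivalent to a model. -/
def HasModel (s : Coeffs) : Prop := ∃ i, LinEquiv s.form (model i).form

theorem HasModel.of_linEquiv {s t : Coeffs} (h : LinEquiv s.form t.form) :
    t.HasModel → s.HasModel := fun ⟨i, hi⟩ => ⟨i, h.trans hi⟩

theorem hasModel_of_scale {s : Coeffs} {ν h κ : ℂ} (hν : ν ≠ 0) (hh : h ≠ 0) (hκ : κ ≠ 0)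
    {i : Fin 4} (e : s.scale ν h κ = model i) : s.HasModel :=
  ⟨i, e ▸ linEquiv_scale s hν hh hκ⟩

/-! ### Singular points with vanishing linear part -/

/-- The linear part of the field vanishes. -/
structure NoLinearPart (s : Coeffs) : Prop where
  p10 : s.p10 = 0
  p01 : s.p01 = 0
  q10 : s.q10 = 0
  q01 : s.q01 = 0

section NoLinearPart

variable {s : Coeffs}

theorem NoLinearPart.swap (h : s.NoLinearPart) : s.swap.NoLinearPart :=
  ⟨h.q01, h.q10, h.p01, h.p10⟩

theorem NoLinearPart.shearX (h : s.NoLinearPart) (t : ℂ) : (s.shearX t).NoLinearPart := by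
  constructor <;> simp [Coeffs.shearX, h.p10, h.p01, h.q10, h.q01]

theorem NoLinearPart.shearY (h : s.NoLinearPart) (t : ℂ) : (s.shearY t).NoLinearPart := by
  constructor <;> simp [Coeffs.shearY, h.p10, h.p01, h.q10, h.q01]

/-- The case where the tangency cubic has a triple root. -/
theorem NoLinearPart.hasModel_of_triple (h : s.NoLinearPart) (hp11 : s.p11 = 0) (hp02 : s.p02 = 0)
    (hq02 : s.q02 = 0) (hpq : s.p20 = s.q11) (hq20 : s.q20 ≠ 0) (hh02 : s.h02 ≠ 0) :
    s.HasModel := by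
  obtain ⟨h1, h2, h3, h4⟩ := h
  obtain ⟨p10, p01, q10, q01, p20, p11, p02, q20, q11, q02, h20, h11, h02⟩ := s
  simp only at *
  subst h1 h2 h3 h4 hp11 hp02 hq02 hpq
  -- the shear removes the term in `x y` of `H`, the twist the one in `x ^ 2`; the scaling
  -- normalizes the coefficients `q20`, `h02` and, when it is not zero, `p20`
  refine HasModel.of_linEquiv (linEquiv_shearY _ (-h11 / (2 * h02))) ?_
  set k := h02 * (-h11 / (2 * h02)) ^ 2 + h11 * (-h11 / (2 * h02)) + h20 with hk
  by_cases ha : p20 = 0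
  · subst ha
    refine HasModel.of_linEquiv (linEquiv_twist _ 0 (-k / q20)) ?_
    refine hasModel_of_scale (ν := 1) (h := -h02 / q20) (κ := 1 / h02) (i := 0) (by simp)
      (by simp [hq20, hh02]) (by simp [hh02]) ?_
    simp only [Coeffs.shearY, twist, scale, model, ← hk, Matrix.cons_val_zero, mk.injEq]
    refine ⟨?_, ?_, ?_, ?_, ?_, ?_, ?_, ?_, ?_, ?_, ?_, ?_, ?_⟩ <;> field_simp <;> ring
  · refine HasModel.of_linEquiv (linEquiv_twist _ (-k / p20) 0) ?_
    refine hasModel_of_scale (ν := -q20 / p20) (h := -(-q20 / p20) ^ 3 * h02 / q20)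
      (κ := 1 / ((-q20 / p20) ^ 3 * h02)) (i := 1) (by simp [hq20, ha])
      (by simp [hq20, hh02, ha]) (by simp [hh02, hq20, ha]) ?_
    simp only [Coeffs.shearY, twist, scale, model, ← hk, Matrix.cons_val_one, Matrix.cons_val_zero,
      mk.injEq]
    refine ⟨?_, ?_, ?_, ?_, ?_, ?_, ?_, ?_, ?_, ?_, ?_, ?_, ?_⟩ <;> field_simp <;> ring

/-- The case where the tangency cubic has a simple and a double root. -/
theorem NoLinearPart.hasModel_of_double (h : s.NoLinearPart) (hp20 : s.p20 = 0) (hp11 : s.p11 = 0)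
    (hp02 : s.p02 = 0) (hq20 : s.q20 = 0) (hq02 : s.q02 = 0) (hq11 : s.q11 ≠ 0)
    (hh20 : s.h20 ≠ 0) (hh02 : s.h02 ≠ 0) : s.HasModel := by
  obtain ⟨h1, h2, h3, h4⟩ := h
  obtain ⟨p10, p01, q10, q01, p20, p11, p02, q20, q11, q02, h20, h11, h02⟩ := s
  simp only at *
  subst h1 h2 h3 h4 hp11 hp02 hq02 hp20 hq20
  refine HasModel.of_linEquiv (linEquiv_twist _ 0 (-h11 / q11)) ?_
  -- the two remaining coefficients of `H` are made equal
  obtain ⟨ν, hν⟩ := IsAlgClosed.exists_pow_nat_eq (h20 / h02) two_pos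
  have hν0 : ν ≠ 0 := by
    rintro rfl
    simp [eq_comm, hh20, hh02] at hν
  have hν' : ν ^ 2 * h02 = h20 := by rw [hν]; field_simp
  refine hasModel_of_scale (ν := ν) (h := -h20 / q11) (κ := 1 / (ν * h20)) (i := 2) hν0
    (by simp [hq11, hh20]) (by simp [hh20, hν0]) ?_
  simp only [twist, scale, model, Matrix.cons_val, mk.injEq]
  refine ⟨?_, ?_, ?_, ?_, ?_, ?_, ?_, ?_, ?_, ?_, ?_, ?_, ?_⟩ <;> field_simp <;>
    first | ring1 | linear_combination q11 ^ 2 * hν'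

theorem NoLinearPart.hasModel_of_vertical_of_horizontal (h : s.NoLinearPart) (hs : s.Good)
    (hp02 : s.p02 = 0) (hq20 : s.q20 = 0) : s.HasModel := by
  obtain ⟨-, hq02, hh02⟩ := hs.coeff_zero_of_vertical h.p01 hp02
  obtain ⟨-, hp20, hh20⟩ := hs.coeff_zero_of_horizontal h.q10 hq20
  by_cases hp11 : s.p11 = 0
  · by_cases hq11 : s.q11 = 0
    · -- the quadratic part vanishes, and the roots of `H` are singular points at infinity
      obtain ⟨v, hv⟩ := exists_quadratic_root (a := s.h02) (b := s.h11) (c := s.h20) (.inl hh02)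
      refine (hs.false_of_point (u := 1) (v := v) (z := 0) (by simp) ?_ ?_ ?_).elim
      · simp only [H]; linear_combination hv
      · simp only [H]; linear_combination v * hv
      · simp [P2, Q2, hp02, hq20, hq02, hp20, hp11, hq11]
    · exact h.hasModel_of_double hp20 hp11 hp02 hq20 hq02 hq11 hh20 hh02
  · by_cases hq11 : s.q11 = 0
    · exact .of_linEquiv s.linEquiv_swap
        (h.swap.hasModel_of_double hq02 hq11 hq20 hp02 hp20 hp11 hh02 hh20)
    · -- a third root of the tangency cubic, where the quadratic part does not vanish
      have := hs.of_tangent (u := s.p11) (v := s.q11) (.inl hp11)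
        (by simp [C2, P1, Q1, h.p10, h.p01, h.q10, h.q01])
        (by simp only [C3, P2, Q2, hp02, hq20, hq02, hp20]; ring)
      simp [P2, hp20, hp02, hp11, hq11] at this

theorem NoLinearPart.hasModel_of_vertical (h : s.NoLinearPart) (hs : s.Good) (hp02 : s.p02 = 0) :
    s.HasModel := by
  obtain ⟨-, hq02, hh02⟩ := hs.coeff_zero_of_vertical h.p01 hp02
  by_cases hr : s.p11 ≠ 0 ∨ s.p20 - s.q11 ≠ 0
  · -- a second root of the tangency cubic is moved to the direction of the `x`-axis
    obtain ⟨t, ht⟩ := exists_quadratic_root (c := -s.q20) hr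
    refine .of_linEquiv (s.linEquiv_shearY t) ((h.shearY t).hasModel_of_vertical_of_horizontal
      (hs.of_linEquiv (s.linEquiv_shearY t)) hp02 ?_)
    simp only [Coeffs.shearY, hp02, hq02]
    linear_combination -ht
  · obtain ⟨hp11, hpq⟩ : s.p11 = 0 ∧ s.p20 - s.q11 = 0 := by tauto
    refine h.hasModel_of_triple hp11 hp02 hq02 (sub_eq_zero.1 hpq) ?_ hh02
    intro hq20
    obtain ⟨-, hp20, -⟩ := hs.coeff_zero_of_horizontal h.q10 hq20
    obtain ⟨v, hv⟩ := exists_quadratic_root (a := s.h02) (b := s.h11) (c := s.h20) (.inl hh02)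
    have hq11 : s.q11 = 0 := by linear_combination hp20 - hpq
    refine hs.false_of_point (u := 1) (v := v) (z := 0) (by simp) ?_ ?_ ?_
    · simp only [H]; linear_combination hv
    · simp only [H]; linear_combination v * hv
    · simp [P2, Q2, hp02, hq20, hq02, hp20, hp11, hq11]

theorem NoLinearPart.hasModel (h : s.NoLinearPart) (hs : s.Good) : s.HasModel := by
  -- a root of the tangency cubic is moved to the direction of the `y`-axis
  by_cases hq20 : s.q20 = 0
  · exact .of_linEquiv s.linEquiv_swap
      (h.swap.hasModel_of_vertical (hs.of_linEquiv s.linEquiv_swap) hq20)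
  · obtain ⟨t, ht⟩ := exists_root_of_coeff_ne_zero
      ![s.p02, s.p11 - s.q02, s.p20 - s.q11, -s.q20] 3 (by simp) (by simpa using hq20)
    refine .of_linEquiv (s.linEquiv_shearX t)
      ((h.shearX t).hasModel_of_vertical (hs.of_linEquiv (s.linEquiv_shearX t)) ?_)
    simp [Fin.sum_univ_four] at ht
    simp only [Coeffs.shearX]
    linear_combination ht

end NoLinearPart

/-! ### Singular points with nonzero linear part -/

section LinearPart

variable {s : Coeffs}

/-- The coefficients of `sextic 1 v` as a polynomial in `v`, when the `y`-axis is an eigenline of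
the linear part. -/
def sexticCoeff (s : Coeffs) : Fin 7 → ℂ :=
  let e := s.p10 - s.q01
  let c0 := -s.q20
  let c1 := s.p20 - s.q11
  let c2 := s.p11 - s.q02
  let c3 := s.p02
  let d0 := s.p10 * s.q20 - s.q10 * s.p20
  let d1 := s.p10 * s.q11 - s.q10 * s.p11 - s.q01 * s.p20
  let d2 := s.p10 * s.q02 - s.q10 * s.p02 - s.q01 * s.p11
  let d3 := -s.q01 * s.p02
  ![s.q10 ^ 2 * s.h20 - c0 * d0,
    s.q10 ^ 2 * s.h11 - 2 * s.q10 * e * s.h20 - (c0 * d1 + c1 * d0),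
    s.q10 ^ 2 * s.h02 - 2 * s.q10 * e * s.h11 + e ^ 2 * s.h20 - (c0 * d2 + c1 * d1 + c2 * d0),
    -2 * s.q10 * e * s.h02 + e ^ 2 * s.h11 - (c0 * d3 + c1 * d2 + c2 * d1 + c3 * d0),
    e ^ 2 * s.h02 - (c1 * d3 + c2 * d2 + c3 * d1),
    -(c2 * d3 + c3 * d2),
    -(c3 * d3)]

theorem sum_sexticCoeff (hp01 : s.p01 = 0) (v : ℂ) :
    ∑ i, s.sexticCoeff i * v ^ (i : ℕ) = s.sextic 1 v := by
  simp [Fin.sum_univ_succ, sexticCoeff, sextic, C2, C3, P1, Q1, P2, Q2, H, hp01]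
  ring

/-- If `C2` vanishes at most on the two axes, `sextic 1 v` has no nonzero root; if moreover it does
not vanish at `v = 0`, it is a polynomial without roots, hence constant. -/
theorem Good.sexticCoeff_eq_zero (hs : s.Good) (hp01 : s.p01 = 0)
    (hC2 : ∀ v, v ≠ 0 → s.C2 1 v ≠ 0) (h0 : s.C2 1 0 ≠ 0 ∨ s.sexticCoeff 0 ≠ 0)
    (k : Fin 7) (hk : (k : ℕ) ≠ 0) : s.sexticCoeff k = 0 := by
  by_contra h
  obtain ⟨v, hv⟩ := exists_root_of_coeff_ne_zero s.sexticCoeff k hk h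
  by_cases hv0 : v = 0
  · subst hv0
    rcases h0 with h0 | h0
    · exact hs.sextic_ne_zero h0 ((sum_sexticCoeff hp01 0).symm.trans hv)
    · exact h0 (by simpa [Fin.sum_univ_succ] using hv)
  · exact hs.sextic_ne_zero (hC2 v hv0) ((sum_sexticCoeff hp01 v).symm.trans hv)

/-- The linear part cannot have a double eigenvalue without being diagonalizable. -/
theorem Good.false_of_jordan_block (hs : s.Good) (hp01 : s.p01 = 0) (hpq : s.p10 = s.q01)
    (hq10 : s.q10 ≠ 0) : False := by
  have hC2 (v) : s.C2 1 v ≠ 0 := by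
    have : s.C2 1 v = -s.q10 := by
      simp only [C2, P1, Q1, hp01, hpq]; ring
    simpa [this] using hq10
  have key := hs.sexticCoeff_eq_zero hp01 (fun v _ => hC2 v) (.inl (hC2 0))
  have h6 := key 6 (by simp)
  have h5 := key 5 (by simp)
  have h3 := key 3 (by simp)
  have h2 := key 2 (by simp)
  simp only [sexticCoeff, Matrix.cons_val, hpq] at h6 h5 h3 h2
  have hp02 : s.p02 = 0 := by
    by_contra h
    have hq01 : s.q01 = 0 := by simpa [h] using h6
    simp [hq01, h, hq10] at h5
  obtain ⟨hq01, hq02, hh02⟩ := hs.coeff_zero_of_vertical hp01 hp02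
  have hp11 : s.p11 = 0 := by
    simpa [hq01, hq02, hp02, hq10] using h3
  simp [hq01, hq02, hp02, hp11, hq10, hh02] at h2

/-- The linear part cannot have two distinct nonzero eigenvalues: the sextic would not vanish on
either axis. -/
theorem Good.false_of_invertible (hs : s.Good) (hp01 : s.p01 = 0) (hq10 : s.q10 = 0)
    (hne : s.p10 - s.q01 ≠ 0) (hp10 : s.p10 ≠ 0) (hq01 : s.q01 ≠ 0) : False := by
  have hq20 : s.q20 ≠ 0 := fun h => hp10 (hs.coeff_zero_of_horizontal hq10 h).1
  have hp02 : s.p02 ≠ 0 := fun h => hq01 (hs.coeff_zero_of_vertical hp01 h).1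
  have h6 := hs.sexticCoeff_eq_zero hp01
    (fun v hv => by
      have : s.C2 1 v = (s.p10 - s.q01) * v := by simp only [C2, P1, Q1, hp01, hq10]; ring
      rw [this]
      exact mul_ne_zero hne hv)
    (.inr (by simp [sexticCoeff, hq10, hp10, hq20])) 6 (by simp)
  simp [sexticCoeff, hp02, hq01] at h6

/-- The case of a saddle-node whose eigenlines are the axes, with vanishing mixed quadratic
terms. -/
theorem Good.hasModel_of_saddleNode_reduced (hs : s.Good) (hp10 : s.p10 = 1) (hp01 : s.p01 = 0)
    (hq10 : s.q10 = 0) (hq01 : s.q01 = 0) (hp11 : s.p11 = 0) (hq11 : s.q11 = 0) : s.HasModel := by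
  have hq20 : s.q20 ≠ 0 := fun h => by
    simpa [hp10] using (hs.coeff_zero_of_horizontal hq10 h).1
  have key := hs.sexticCoeff_eq_zero hp01
    (fun v hv => by simpa [C2, P1, Q1, hp01, hq10, hp10, hq01] using hv)
    (.inr (by simp [sexticCoeff, hq10, hp10, hq20]))
  have h1 := key 1 (by simp)
  have h2 := key 2 (by simp)
  have h3 := key 3 (by simp)
  have h4 := key 4 (by simp)
  have h5 := key 5 (by simp)
  simp only [sexticCoeff, Matrix.cons_val, hp10, hq10, hq01, hp11, hq11] at h1 h2 h3 h4 h5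
  have hp02 : s.p02 ≠ 0 := fun h => by
    obtain ⟨-, hq02, hh02⟩ := hs.coeff_zero_of_vertical hp01 h
    simp [hq02, h, hh02] at h4
  have hq02 : s.q02 = 0 := by simpa [hp02] using h5
  have hp20 : s.p20 = 0 := by simpa [hq20] using h1
  have hh20 : s.h20 = 0 := by simpa [hq02, hp20] using h2
  have hh02 : s.h02 = 0 := by simpa [hq02, hp20] using h4
  have hh11 : s.h11 = s.p02 * s.q20 := by
    simp only [hq02, hp20] at h3
    linear_combination h3
  -- `H = p02 * q20 * x * y`, and a rescaling turns `p02`, `q20` into `1`, `-1`: with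
  -- `ν ^ 3 = -q20 / p02` all four remaining coefficients are matched at once
  obtain ⟨ν, hν⟩ := IsAlgClosed.exists_pow_nat_eq (-s.q20 / s.p02) three_pos
  have hν0 : ν ≠ 0 := by
    rintro rfl
    simp [eq_comm, hp02, hq20] at hν
  have hν' : ν ^ 3 * s.p02 = -s.q20 := by rw [hν]; field_simp
  refine hasModel_of_scale (ν := ν) (h := -s.q20 / ν) (κ := ν / s.q20 ^ 2) (i := 3) hν0
    (by simp [hq20, hν0]) (by simp [hq20, hν0]) ?_
  simp only [scale, model, Matrix.cons_val, mk.injEq, hp10, hp01, hq10, hq01, hp11, hq11, hq02,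
    hp20, hh20, hh02, hh11]
  refine ⟨?_, ?_, ?_, ?_, ?_, ?_, ?_, ?_, ?_, ?_, ?_, ?_, ?_⟩ <;> field_simp <;>
    first | ring1 | linear_combination hν' | linear_combination -hν'

/-- After a twist which removes the terms in `x y` of the quadratic part, the reduced case
applies. -/
theorem Good.hasModel_of_saddleNode (hs : s.Good) (hp01 : s.p01 = 0) (hq10 : s.q10 = 0)
    (hq01 : s.q01 = 0) (hp10 : s.p10 ≠ 0) : s.HasModel := by
  have e1 := linEquiv_scale s one_ne_zero one_ne_zero (inv_ne_zero hp10)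
  have e2 := linEquiv_twist (s.scale 1 1 s.p10⁻¹) (-s.q11 / s.p10) (-s.p11 / s.p10)
  refine .of_linEquiv (e1.trans e2) ?_
  refine (hs.of_linEquiv (e1.trans e2)).hasModel_of_saddleNode_reduced ?_ ?_ ?_ ?_ ?_ ?_ <;>
    simp only [twist, scale, hp01, hq10, hq01] <;> field_simp <;> ring1

theorem Good.hasModel_of_diagonal (hs : s.Good) (hp01 : s.p01 = 0) (hq10 : s.q10 = 0)
    (hne : s.p10 - s.q01 ≠ 0) : s.HasModel := by
  by_cases hq01 : s.q01 = 0
  · exact hs.hasModel_of_saddleNode hp01 hq10 hq01 (by simpa [hq01] using hne)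
  · by_cases hp10 : s.p10 = 0
    · exact .of_linEquiv s.linEquiv_swap ((hs.of_linEquiv s.linEquiv_swap).hasModel_of_saddleNode
        hq10 hp01 hp10 hq01)
    · exact (hs.false_of_invertible hp01 hq10 hne hp10 hq01).elim

/-- A radial linear part is excluded by the lines on which the tangency cubic vanishes. -/
theorem Good.noLinearPart_of_radial (hs : s.Good) (hp01 : s.p01 = 0) (hq10 : s.q10 = 0)
    (hpq : s.p10 = s.q01) : s.NoLinearPart := by
  have hC2 (u v) : s.C2 u v = 0 := by
    simp only [C2, P1, Q1, hp01, hq10, hpq]; ring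
  suffices s.q01 = 0 from ⟨hpq.trans this, hp01, hq10, this⟩
  by_cases hq20 : s.q20 = 0
  · exact hpq ▸ (hs.coeff_zero_of_horizontal hq10 hq20).1
  · obtain ⟨t, ht⟩ := exists_root_of_coeff_ne_zero
      ![s.p02, s.p11 - s.q02, s.p20 - s.q11, -s.q20] 3 (by simp) (by simpa using hq20)
    simp [Fin.sum_univ_four] at ht
    have := hs.of_tangent (u := t) (v := 1) (by simp) (hC2 _ _)
      (by simp only [C3, P2, Q2]; linear_combination ht)
    simpa [Q1, hq10] using this.2.1

theorem Good.hasModel_of_eigenline (hs : s.Good) (hp01 : s.p01 = 0) : s.HasModel := by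
  by_cases hpq : s.p10 - s.q01 = 0
  · by_cases hq10 : s.q10 = 0
    · exact (hs.noLinearPart_of_radial hp01 hq10 (sub_eq_zero.1 hpq)).hasModel hs
    · exact (hs.false_of_jordan_block hp01 (sub_eq_zero.1 hpq) hq10).elim
  · refine .of_linEquiv (s.linEquiv_shearY (s.q10 / (s.p10 - s.q01))) ?_
    refine (hs.of_linEquiv (s.linEquiv_shearY _)).hasModel_of_diagonal hp01 ?_ ?_
    · simp only [shearY, hp01]
      field_simp
      ring
    · simpa [shearY, hp01] using hpq

/-- Every normal form with a single singular point is equivalent to a model. -/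
theorem Good.hasModel (hs : s.Good) : s.HasModel := by
  -- an eigenline of the linear part is moved to the `y`-axis
  by_cases hq10 : s.q10 = 0
  · exact .of_linEquiv s.linEquiv_swap
      ((hs.of_linEquiv s.linEquiv_swap).hasModel_of_eigenline hq10)
  · obtain ⟨t, ht⟩ := exists_quadratic_root (a := -s.q10) (b := s.p10 - s.q01) (c := s.p01)
      (.inl (by simpa using hq10))
    refine .of_linEquiv (s.linEquiv_shearX t)
      ((hs.of_linEquiv (s.linEquiv_shearX t)).hasModel_of_eigenline ?_)
    simp only [shearX]
    linear_combination ht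

end LinearPart
end Coeffs

/-! ### Reduction to the normal form -/

/-- The exponent vector of `X ^ i Y ^ j Z ^ k`. -/
def expo (i j k : ℕ) : Fin 3 →₀ ℕ := Finsupp.equivFunOnFinite.symm ![i, j, k]

theorem eval_eq_of_isHomogeneous_three {f : MvPolynomial (Fin 3) ℂ} (hf : f.IsHomogeneous 3)
    (v : Fin 3 → ℂ) :
    eval v f = f.coeff (expo 3 0 0) * v 0 ^ 3 + f.coeff (expo 2 1 0) * (v 0 ^ 2 * v 1)
      + f.coeff (expo 1 2 0) * (v 0 * v 1 ^ 2) + f.coeff (expo 0 3 0) * v 1 ^ 3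
      + f.coeff (expo 2 0 1) * (v 0 ^ 2 * v 2) + f.coeff (expo 1 1 1) * (v 0 * v 1 * v 2)
      + f.coeff (expo 0 2 1) * (v 1 ^ 2 * v 2) + f.coeff (expo 1 0 2) * (v 0 * v 2 ^ 2)
      + f.coeff (expo 0 1 2) * (v 1 * v 2 ^ 2) + f.coeff (expo 0 0 3) * v 2 ^ 3 := by
  have hsub : f.support ⊆ (Finset.Nat.antidiagonalTuple 3 3).map
      Finsupp.equivFunOnFinite.symm.toEmbedding := by
    intro d hd
    have : ∑ i, d i = 3 := by
      have := hf (mem_support_iff.mp hd)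
      simpa [Finsupp.weight_apply, Finsupp.sum_fintype] using this
    simpa [Finset.mem_map_equiv, Finset.Nat.mem_antidiagonalTuple] using this
  have hT : Finset.Nat.antidiagonalTuple 3 3 = {![3, 0, 0], ![2, 1, 0], ![1, 2, 0], ![0, 3, 0],
      ![2, 0, 1], ![1, 1, 1], ![0, 2, 1], ![1, 0, 2], ![0, 1, 2], ![0, 0, 3]} := by decide
  rw [eval_eq', Finset.sum_subset hsub (fun d _ hd => by
    rw [notMem_support_iff.mp hd, zero_mul]), Finset.sum_map, hT]
  simp [Finset.sum_insert, Fin.prod_univ_three, expo]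
  ring

theorem coeff_euler {ω : OneForm} (h : ∑ i, ω i * X i = 0) (i j k : ℕ) :
    (if i = 0 then 0 else (ω 0).coeff (expo (i - 1) j k))
      + (if j = 0 then 0 else (ω 1).coeff (expo i (j - 1) k))
      + (if k = 0 then 0 else (ω 2).coeff (expo i j (k - 1))) = 0 := by
  have h0 : expo i j k - Finsupp.single 0 1 = expo (i - 1) j k := by
    ext l; fin_cases l <;> simp [expo]
  have h1 : expo i j k - Finsupp.single 1 1 = expo i (j - 1) k := by
    ext l; fin_cases l <;> simp [expo]
  have h2 : expo i j k - Finsupp.single 2 1 = expo i j (k - 1) := by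
    ext l; fin_cases l <;> simp [expo]
  have := congrArg (coeff (expo i j k)) h
  simp only [Fin.sum_univ_three, coeff_add, coeff_mul_X', h0, h1, h2, coeff_zero,
    Finsupp.mem_support_iff] at this
  simpa [expo, ite_not] using this

theorem IsFoliationForm.exists_eq_form {ω : OneForm} (hω : IsFoliationForm 2 ω)
    (h0 : ∀ i, eval ![0, 0, 1] (ω i) = 0) : ∃ s : Coeffs, ω = s.form := by
  have hA := eval_eq_of_isHomogeneous_three (hω.homogeneous 0)
  have hB := eval_eq_of_isHomogeneous_three (hω.homogeneous 1)
  have hC := eval_eq_of_isHomogeneous_three (hω.homogeneous 2)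
  have a003 : (ω 0).coeff (expo 0 0 3) = 0 := by simpa [h0] using (hA ![0, 0, 1]).symm
  have b003 : (ω 1).coeff (expo 0 0 3) = 0 := by simpa [h0] using (hB ![0, 0, 1]).symm
  have E := coeff_euler hω.euler
  have e400 := E 4 0 0
  have e310 := E 3 1 0
  have e220 := E 2 2 0
  have e130 := E 1 3 0
  have e040 := E 0 4 0
  have e301 := E 3 0 1
  have e211 := E 2 1 1
  have e121 := E 1 2 1
  have e031 := E 0 3 1
  have e202 := E 2 0 2
  have e112 := E 1 1 2
  have e022 := E 0 2 2
  have e103 := E 1 0 3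
  have e013 := E 0 1 3
  have e004 := E 0 0 4
  norm_num at e400 e310 e220 e130 e040 e301 e211 e121 e031 e202 e112 e022 e103 e013 e004
  refine ⟨{ p10 := (ω 1).coeff (expo 1 0 2), p01 := (ω 1).coeff (expo 0 1 2),
            q10 := -(ω 0).coeff (expo 1 0 2), q01 := -(ω 0).coeff (expo 0 1 2),
            p20 := (ω 1).coeff (expo 2 0 1), p11 := (ω 1).coeff (expo 1 1 1),
            p02 := (ω 1).coeff (expo 0 2 1),
            q20 := -(ω 0).coeff (expo 2 0 1), q11 := -(ω 0).coeff (expo 1 1 1),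
            q02 := -(ω 0).coeff (expo 0 2 1),
            h20 := -(ω 0).coeff (expo 2 1 0), h11 := -(ω 0).coeff (expo 1 2 0),
            h02 := -(ω 0).coeff (expo 0 3 0) }, ?_⟩
  funext i
  apply MvPolynomial.funext
  intro v
  fin_cases i
  · simp only [Fin.zero_eta, hA, Coeffs.eval_form_zero, Coeffs.Q1, Coeffs.Q2, Coeffs.H]
    linear_combination v 0 ^ 3 * e400 + v 2 ^ 3 * a003
  · simp only [Fin.mk_one, hB, Coeffs.eval_form_one, Coeffs.P1, Coeffs.P2, Coeffs.H]
    linear_combination v 0 ^ 3 * e310 + v 0 ^ 2 * v 1 * e220 + v 0 * v 1 ^ 2 * e130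
      + v 1 ^ 3 * e040 + v 2 ^ 3 * b003
  · simp only [Fin.reduceFinMk, hC, Coeffs.eval_form_two, Coeffs.P1, Coeffs.P2, Coeffs.Q1,
      Coeffs.Q2]
    linear_combination v 0 ^ 3 * e301 + v 0 ^ 2 * v 1 * e211 + v 0 * v 1 ^ 2 * e121
      + v 1 ^ 3 * e031 + v 0 ^ 2 * v 2 * e202 + v 0 * v 1 * v 2 * e112 + v 1 ^ 2 * v 2 * e022
      + v 0 * v 2 ^ 2 * (e103 - a003) + v 1 * v 2 ^ 2 * (e013 - b003) + v 2 ^ 3 * e004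

theorem exists_mulVec_eq {w : Fin 3 → ℂ} (hw : w ≠ 0) :
    ∃ g : GL (Fin 3) ℂ, g.1.mulVec ![0, 0, 1] = w := by
  suffices ∃ g : Matrix (Fin 3) (Fin 3) ℂ, g.det ≠ 0 ∧ g.mulVec ![0, 0, 1] = w by
    obtain ⟨g, hg, h⟩ := this
    exact ⟨Matrix.GeneralLinearGroup.mkOfDetNeZero g hg, h⟩
  obtain ⟨i, hi⟩ := Function.ne_iff.1 hw
  fin_cases i
  · refine ⟨!![0, 0, w 0; 1, 0, w 1; 0, 1, w 2], by simpa [Matrix.det_fin_three] using hi, ?_⟩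
    funext j
    fin_cases j <;> simp
  · refine ⟨!![1, 0, w 0; 0, 0, w 1; 0, 1, w 2], by simpa [Matrix.det_fin_three] using hi, ?_⟩
    funext j
    fin_cases j <;> simp
  · refine ⟨!![1, 0, w 0; 0, 1, w 1; 0, 0, w 2], by simpa [Matrix.det_fin_three] using hi, ?_⟩
    funext j
    fin_cases j <;> simp

/-- A foliation form of degree two with a single singular point is linearly equivalent to a normal
form. -/
theorem IsFoliationForm.exists_linEquiv_form {ω : OneForm} (hω : IsFoliationForm 2 ω) {p : P2}
    (hp : (Foliation.mk ω hω).sing = {p}) : ∃ s : Coeffs, s.Good ∧ LinEquiv ω s.form := by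
  obtain ⟨w, hw, hz, hwp⟩ : p ∈ (Foliation.mk ω hω).sing := hp ▸ rfl
  obtain ⟨g, hg⟩ := exists_mulVec_eq hw
  have hzero := eval_pullback_eq_zero_iff g ω
  obtain ⟨s, hs⟩ := (hω.pullback g).exists_eq_form ((hzero _).2 (by rwa [hg]))
  refine ⟨s, fun v hv => ?_, g, 1, by simpa using hs⟩
  rw [← hs, hzero] at hv
  by_cases hv0 : g.1.mulVec v = 0
  · have : v = 0 := mulVec_injective g (hv0.trans (Matrix.mulVec_zero _).symm)
    simp [this]
  · have hmem : Projectivization.mk ℂ _ hv0 ∈ (Foliation.mk ω hω).sing := ⟨_, hv0, hv, rfl⟩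
    rw [hp, Set.mem_singleton_iff, ← hwp, Projectivization.mk_eq_mk_iff'] at hmem
    obtain ⟨a, ha⟩ := hmem
    rw [← hg, ← Matrix.mulVec_smul] at ha
    simp [← mulVec_injective g ha]

theorem Foliation.mk_mem_orbit_iff {N : ℕ} {ω η : OneForm} (hω : IsFoliationForm N ω)
    (hη : IsFoliationForm N η) :
    Foliation.mk η hη ∈ MulAction.orbit AutP2 (Foliation.mk ω hω) ↔ LinEquiv ω η := by
  constructor
  · rintro ⟨g, hg⟩
    induction g using Matrix.ProjGenLinGroup.induction_on with | mk g => ?_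
    obtain ⟨c, hc⟩ := Quotient.exact (s := formSetoid N) hg
    exact ⟨g⁻¹, c, hc⟩
  · rintro ⟨g, c, h⟩
    refine ⟨Matrix.ProjGenLinGroup.mk g⁻¹, Quotient.sound (s := formSetoid N) ⟨c, ?_⟩⟩
    change (c : ℂ) • PlaneFoliation.pullback (g⁻¹⁻¹).1 ω = η
    rw [inv_inv, h]

/-! ### The models -/

namespace Coeffs

theorem isHomogeneous_form (s : Coeffs) (i : Fin 3) : (s.form i).IsHomogeneous 3 := by
  have hX (i : Fin 3) : (X i : MvPolynomial (Fin 3) ℂ).IsHomogeneous 1 := isHomogeneous_X _ _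
  have h1 (a b : ℂ) : (C a * X 0 + C b * X 1 : MvPolynomial (Fin 3) ℂ).IsHomogeneous 1 :=
    ((hX 0).C_mul a).add ((hX 1).C_mul b)
  have h2 (a b c : ℂ) : (C a * X 0 ^ 2 + C b * (X 0 * X 1) + C c * X 1 ^ 2 :
      MvPolynomial (Fin 3) ℂ).IsHomogeneous 2 :=
    ((((hX 0).pow 2).C_mul a).add (((hX 0).mul (hX 1)).C_mul b)).add (((hX 1).pow 2).C_mul c)
  fin_cases i
  · exact (((((hX 2).pow 2).mul (h1 _ _)).add ((hX 2).mul (h2 _ _ _))).add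
      ((hX 1).mul (h2 _ _ _))).neg
  · exact ((((hX 2).pow 2).mul (h1 _ _)).add ((hX 2).mul (h2 _ _ _))).add
      ((hX 0).mul (h2 _ _ _))
  · exact ((hX 2).mul (((hX 0).mul (h1 _ _)).sub ((hX 1).mul (h1 _ _)))).add
      (((hX 0).mul (h2 _ _ _)).sub ((hX 1).mul (h2 _ _ _)))

theorem euler_form (s : Coeffs) : ∑ i, s.form i * X i = 0 := by
  simp [form, Fin.sum_univ_three]
  ring

theorem form_model_zero : (model 0).form = ![X 0 ^ 2 * X 2 - X 1 ^ 3, X 0 * X 1 ^ 2, -X 0 ^ 3] := by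
  funext i
  fin_cases i <;> simp [form, model] <;> ring

theorem form_model_one : (model 1).form = ![X 0 ^ 2 * X 2 - X 0 * X 1 * X 2 - X 1 ^ 3,
    X 0 ^ 2 * X 2 + X 0 * X 1 ^ 2, -X 0 ^ 3] := by
  funext i
  fin_cases i <;> simp [form, model] <;> ring

theorem form_model_two : (model 2).form = ![X 0 * X 1 * X 2 - X 1 * (X 0 ^ 2 + X 1 ^ 2),
    X 0 * (X 0 ^ 2 + X 1 ^ 2), -(X 0 ^ 2 * X 1)] := by
  funext i
  fin_cases i <;> simp [form, model] <;> ring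

theorem form_model_three : (model 3).form = ![X 0 * (X 0 * X 2 + X 1 ^ 2),
    X 0 * X 2 ^ 2 + X 1 ^ 2 * X 2 - X 0 ^ 2 * X 1,
    -(X 0 ^ 3 + X 1 * (X 0 * X 2 + X 1 ^ 2))] := by
  funext i
  fin_cases i <;> simp [form, model] <;> ring

/-- An irreducible divisor of a variable is associated to it, hence divides only polynomials
vanishing on the corresponding coordinate plane. -/
theorem false_of_dvd_X {d f : MvPolynomial (Fin 3) ℂ} (hd : Irreducible d) {i : Fin 3}
    (hX : d ∣ X i) (hf : d ∣ f) (v : Fin 3 → ℂ) (hv : v i = 0) (h : eval v f ≠ 0) : False := by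
  have hXi : Irreducible (X i : MvPolynomial (Fin 3) ℂ) := (X_prime (i := i)).irreducible
  obtain ⟨q, rfl⟩ := ((hd.associated_of_dvd hXi hX).symm.dvd).trans hf
  simp [hv] at h

theorem false_of_dvd_form_model {d : MvPolynomial (Fin 3) ℂ} (hd : Irreducible d) (k : Fin 4)
    (h : ∀ i, d ∣ (model k).form i) : False := by
  have hp := hd.prime
  have h0 := h 0
  have h1 := h 1
  have h2 := h 2
  fin_cases k
  · simp only [Fin.zero_eta, form_model_zero, Matrix.cons_val, dvd_neg] at h0 h2
    exact false_of_dvd_X hd (hp.dvd_of_dvd_pow h2) h0 ![0, 1, 0] rfl (by simp)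
  · simp only [Fin.mk_one, form_model_one, Matrix.cons_val, dvd_neg] at h0 h2
    exact false_of_dvd_X hd (hp.dvd_of_dvd_pow h2) h0 ![0, 1, 0] rfl (by simp)
  · simp only [Fin.reduceFinMk, form_model_two, Matrix.cons_val, dvd_neg] at h0 h1 h2
    rcases hp.dvd_or_dvd h2 with h2 | h2
    · exact false_of_dvd_X hd (hp.dvd_of_dvd_pow h2) h0 ![0, 1, 0] rfl (by simp)
    · exact false_of_dvd_X hd h2 h1 ![1, 0, 0] rfl (by simp)
  · simp only [Fin.reduceFinMk, form_model_three, Matrix.cons_val, dvd_neg] at h0 h2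
    rcases hp.dvd_or_dvd h0 with h0 | h0
    · exact false_of_dvd_X hd h0 h2 ![0, 1, 0] rfl (by simp)
    · have h3 := (dvd_add_left (h0.mul_left (X 1))).1 h2
      exact false_of_dvd_X hd (hp.dvd_of_dvd_pow h3) h0 ![0, 1, 0] rfl (by simp)

theorem isFoliationForm_model (k : Fin 4) : IsFoliationForm 2 (model k).form where
  homogeneous := isHomogeneous_form _
  euler := euler_form _
  no_common_component d hd := by
    by_contra hu
    have hd0 : d ≠ 0 := by
      rintro rfl
      have h2 := zero_dvd_iff.1 (hd 2)
      have := congrArg (eval ![1, 1, 0]) h2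
      fin_cases k <;> simp [eval_form_two, model, P1, Q1, P2, Q2] at this
      norm_num at this
    obtain ⟨p, hp, hpd⟩ := WfDvdMonoid.exists_irreducible_factor hu hd0
    exact false_of_dvd_form_model hp k fun i => hpd.trans (hd i)

theorem good_model (k : Fin 4) : (model k).Good := by
  intro v hv
  have h0 := hv 0
  have h1 := hv 1
  have h2 := hv 2
  fin_cases k
  · simp [form_model_zero] at h0 h2
    simp_all
  · simp [form_model_one] at h0 h2
    simp_all
  · simp [form_model_two] at h0 h1 h2
    rcases h2 with h2 | h2 <;> simp_all
  · simp [form_model_three] at h0 h1 h2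
    rcases h0 with h0 | h0
    · simp_all
    · have h3 : v 0 = 0 := by simpa [h0] using h2
      simp_all

theorem sing_model (k : Fin 4) (hω : IsFoliationForm 2 (model k).form) :
    (Foliation.mk _ hω).sing = {Projectivization.mk ℂ ![0, 0, 1] (by simp)} := by
  ext p
  rw [Set.mem_singleton_iff]
  constructor
  · rintro ⟨v, hv, hz, rfl⟩
    obtain ⟨h0, h1⟩ := good_model k v hz
    rw [Projectivization.mk_eq_mk_iff']
    refine ⟨v 2, ?_⟩
    funext i
    fin_cases i <;> simp [h0, h1]
  · rintro rfl
    exact ⟨_, by simp, eval_form_origin _, rfl⟩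

theorem restrictChart_model (k : Fin 4) : restrictChart (model k).form = modelForm k := by
  funext i
  fin_cases k
  · fin_cases i <;> simp [restrictChart, form_model_zero, modelForm, dx, dy] <;> ring
  · fin_cases i <;> simp [restrictChart, form_model_one, modelForm, dx, dy] <;> ring
  · fin_cases i <;> simp [restrictChart, form_model_two, modelForm, dx, dy] <;> ring
  · fin_cases i <;> simp [restrictChart, form_model_three, modelForm, dx, dy]

/-! ### The models are pairwise inequivalent -/

/-- An equivalence fixes the singular point, so its matrix is block triangular. -/
theorem Good.exists_block_of_linEquiv {s t : Coeffs} (hs : s.Good)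
    (h : LinEquiv s.form t.form) :
    ∃ (c : ℂ) (g : Matrix (Fin 3) (Fin 3) ℂ), c ≠ 0 ∧ g 0 2 = 0 ∧ g 1 2 = 0 ∧
      g 0 0 * g 1 1 - g 0 1 * g 1 0 ≠ 0 ∧ g 2 2 ≠ 0 ∧
      ∀ v j, c * ∑ i, g i j * eval (g.mulVec v) (s.form i) = eval v (t.form j) := by
  obtain ⟨g, c, h⟩ := h
  have h0 := hs _ ((linEquiv_eval_zero h _).1 t.eval_form_origin)
  simp [Matrix.mulVec, dotProduct, Fin.sum_univ_three] at h0
  have hdet : g.1.det ≠ 0 := g.1.isUnit_iff_isUnit_det.1 g.isUnit |>.ne_zero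
  rw [Matrix.det_fin_three, h0.1, h0.2] at hdet
  have hdet' : (g.1 0 0 * g.1 1 1 - g.1 0 1 * g.1 1 0) * g.1 2 2 ≠ 0 := by
    convert hdet using 1; ring
  refine ⟨c, g.1, c.ne_zero, h0.1, h0.2, left_ne_zero_of_mul hdet', right_ne_zero_of_mul hdet',
    fun v j => ?_⟩
  rw [← h, ← eval_pullback]
  simp [smul_eval]

theorem eval_model_two_of_ne {i : Fin 4} (hi : i < 3) (v w : Fin 3 → ℂ) (h0 : v 0 = w 0)
    (h1 : v 1 = w 1) : eval v ((model i).form 2) = eval w ((model i).form 2) := by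
  fin_cases i
  · simp [form_model_zero, h0]
  · simp [form_model_one, h0]
  · simp [form_model_two, h0, h1]
  · simp at hi

/-- Only the fourth model has a nonzero linear part: its coefficient of `dZ` depends on `Z`. -/
theorem not_linEquiv_model_three {i : Fin 4} (hi : i < 3) :
    ¬ LinEquiv (model i).form (model 3).form := by
  intro h
  obtain ⟨c, g, -, g02, g12, -, -, H⟩ := (good_model i).exists_block_of_linEquiv h
  have e0 := H ![1, 1, 0] 2
  have e1 := H ![1, 1, 1] 2
  simp only [Fin.sum_univ_three, g02, g12, zero_mul, zero_add] at e0 e1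
  rw [eval_model_two_of_ne hi _ (g.mulVec ![1, 1, 0])
    (by simp [Matrix.mulVec, dotProduct, Fin.sum_univ_three, g02])
    (by simp [Matrix.mulVec, dotProduct, Fin.sum_univ_three, g12]), e0] at e1
  simp [form_model_three] at e1

/-- The tangency cubic of the third model has two roots, that of the first two models only one. -/
theorem not_linEquiv_model_two {i : Fin 4} (hi : i < 2) :
    ¬ LinEquiv (model i).form (model 2).form := by
  intro h
  obtain ⟨c, g, hc, g02, g12, hdet, g22, H⟩ := (good_model i).exists_block_of_linEquiv h
  have hi' (v : Fin 3 → ℂ) : eval v ((model i).form 2) = -v 0 ^ 3 := by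
    fin_cases i
    · simp [form_model_zero]
    · simp [form_model_one]
    · simp at hi
    · simp at hi
  have e0 := H ![1, 0, 0] 2
  have e1 := H ![0, 1, 0] 2
  simp [Fin.sum_univ_three, g02, g12, hi', form_model_two, hc, g22, Matrix.mulVec, dotProduct]
    at e0 e1
  simp [e0, e1] at hdet

/-- The coefficient of `dY` depends on `Z` in the second model, but not in a form equivalent to the
first model whose coefficient of `dZ` is a multiple of `X ^ 3`. -/
theorem not_linEquiv_model_one : ¬ LinEquiv (model 0).form (model 1).form := by
  intro h
  obtain ⟨c, g, hc, g02, g12, hdet, g22, H⟩ := (good_model 0).exists_block_of_linEquiv h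
  have g01 := H ![0, 1, 0] 2
  simp [Fin.sum_univ_three, g02, g12, form_model_zero, form_model_one, hc, g22, Matrix.mulVec,
    dotProduct] at g01
  -- the coefficient of `dY` in the pull-back does not depend on `Z`
  have e0 := H ![1, 0, 0] 1
  have e1 := H ![1, 0, 1] 1
  simp [Fin.sum_univ_three, g01, g02, g12, form_model_zero, form_model_one, Matrix.mulVec,
    dotProduct] at e0 e1
  rcases e0 with e0 | e0 <;> simp [e0] at e1

theorem not_linEquiv_model {i j : Fin 4} (hij : i < j) :
    ¬ LinEquiv (model i).form (model j).form := by
  fin_cases j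
  · simp at hij
  · obtain rfl : i = 0 := by simpa using hij
    exact not_linEquiv_model_one
  · exact not_linEquiv_model_two hij
  · exact not_linEquiv_model_three hij

end Coeffs
end PlaneFoliation

end

open PlaneFoliation in
/-- Up to automorphisms of the complex projective plane there are exactly four foliations of
degree two with a single singular point, described in the affine chart `Z = 1` by the four model
forms. -/
theorem mainTheorem1 :
    ∃ F : Fin 4 → Foliation 2,
      (∀ i, (F i).IsDescribedBy (modelForm i)) ∧
      (∀ i, ∃ p : P2, (F i).sing = {p}) ∧
      (∀ i j, F i ∈ MulAction.orbit AutP2 (F j) → i = j) ∧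
      (∀ G : Foliation 2, (∃ p : P2, G.sing = {p}) → ∃ i, G ∈ MulAction.orbit AutP2 (F i)) := by
  refine ⟨fun i => Foliation.mk _ (Coeffs.isFoliationForm_model i),
    fun i => ⟨_, _, rfl, Coeffs.restrictChart_model i⟩, fun i => ⟨_, Coeffs.sing_model i _⟩,
    fun i j h => ?_, fun G ⟨p, hp⟩ => ?_⟩
  · rw [Foliation.mk_mem_orbit_iff] at h
    rcases lt_trichotomy i j with hij | hij | hij
    · exact (Coeffs.not_linEquiv_model hij h.symm).elim
    · exact hij
    · exact (Coeffs.not_linEquiv_model hij h).elim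
  · induction G using Quotient.ind with | _ ω => ?_
    obtain ⟨ω, hω⟩ := ω
    obtain ⟨s, hs, h⟩ := hω.exists_linEquiv_form hp
    obtain ⟨i, hi⟩ := hs.hasModel
    exact ⟨i, (Foliation.mk_mem_orbit_iff (Coeffs.isFoliationForm_model i) hω).2
      (h.trans hi).symm⟩
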